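/- Let $A,T\in\mathbb M_n$ be complex $n\times n$ matrices with $A$ positive semidefinite, and let $p\ge 1$ be a real number. Write $|X|=(X^*X)^{1/2}$, and for positive semidefinite $X,Y\in\mathbb M_n$ write $X\prec_{w\log}Y$ when $$\prod_{j=1}^k\lambda_j(X)\le\prod_{j=1}^k\lambda_j(Y)\qquad\text{for } k=1,\dots,n,$$ where $\lambda_1(\cdot)\ge\dots\ge\lambda_n(\cdot)$ are the eigenvalues, counted with multiplicity, in decreasing order. Then $$\left|A\,\frac{T+T^*}{2}\,A\right|^p\prec_{w\log}A^p\,\frac{|T|^p+|T^*|^p}{2}\,A^p .$$ -/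

import Mathlib

open scoped MatrixOrder ComplexOrder

/-- `X ≺_{w log} Y` for complex positive semidefinite `n × n` matrices: for `k = 1, …, n`, the
product of the `k` largest eigenvalues of `X` is at most that of the `k` largest eigenvalues of `Y`.
`Matrix.IsHermitian.eigenvalues₀` lists the eigenvalues, with multiplicity, in decreasing order. -/
def WeakLogMajorizedBy {n : ℕ} (X Y : Matrix (Fin n) (Fin n) ℂ) : Prop :=
  ∃ (hX : X.PosSemidef) (hY : Y.PosSemidef), ∀ k : ℕ, 1 ≤ k → k ≤ n →
    ∏ j : Fin (Fintype.card (Fin n)) with j.val < k, hX.isHermitian.eigenvalues₀ j ≤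
      ∏ j : Fin (Fintype.card (Fin n)) with j.val < k, hY.isHermitian.eigenvalues₀ j

/-! The norm of the `k`-th compound `C(X)` of a positive semidefinite `X` is the product of its `k`
largest eigenvalues. Since `C` is multiplicative and commutes with adjoints and powers, the claim
becomes a norm inequality for each `k`. Let `H` be the real part of `T` and `N` the mean of `|T|^p`
and `|T*|^p`. Positivity of a block matrix and operator concavity of `t ↦ t^(1/p)` give `±H ≤ (|T| +
|T*|)/2 ≤ N^(1/p)`. Replace `N` by an invertible `R = N + ε` and put `S = R^(1/(2p))`. Then `H = S K
S` with `-1 ≤ K ≤ 1`, so `AHA = (AS) K (AS)*` and `‖C(AHA)‖ ≤ ‖C(A) C(S)‖²`. The Cordes inequality,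
applied to the compounds, bounds the `p`-th power of the right side by `‖C(A^p R^(1/2))‖² = ‖C(A^p R
A^p)‖`. Finally `ε → 0`. -/

section
open scoped Matrix.Norms.L2Operator

/-! ### Compound matrices and their functoriality -/

section
variable {n k : ℕ}

/-- The `k`-th compound matrix: the matrix of all `k × k` minors. -/
noncomputable def Matrix.compound (k : ℕ) (A : Matrix (Fin n) (Fin n) ℂ) :
    Matrix (Set.powersetCard (Fin n) k) (Set.powersetCard (Fin n) k) ℂ :=
  .of fun s t => (A.submatrix (Set.powersetCard.ofFinEmbEquiv.symm s)
    (Set.powersetCard.ofFinEmbEquiv.symm t)).det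

namespace Matrix

/-- Reduces multiplicativity (Cauchy–Binet) to functoriality of the exterior power. -/
lemma compound_eq_toMatrix (A : Matrix (Fin n) (Fin n) ℂ) :
    A.compound k = LinearMap.toMatrix ((Pi.basisFun ℂ (Fin n)).exteriorPower k)
      ((Pi.basisFun ℂ (Fin n)).exteriorPower k) (exteriorPower.map k (Matrix.toLin' A)) := by
  ext s t
  rw [LinearMap.toMatrix_apply, exteriorPower.basis_apply, exteriorPower.basis_repr_apply,
    exteriorPower.map_apply_ιMulti_family, exteriorPower.ιMulti_family,
    exteriorPower.ιMultiDual_apply_ιMulti, compound, Matrix.of_apply, ← Matrix.det_transpose]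
  congr 1
  ext i j
  simp [Matrix.toLin'_apply, Matrix.mulVec_single]

lemma compound_mul (A B : Matrix (Fin n) (Fin n) ℂ) :
    (A * B).compound k = A.compound k * B.compound k := by
  simp only [compound_eq_toMatrix]
  rw [Matrix.toLin'_mul, exteriorPower.map_comp,
    LinearMap.toMatrix_comp _ ((Pi.basisFun ℂ (Fin n)).exteriorPower k)]

lemma compound_one : (1 : Matrix (Fin n) (Fin n) ℂ).compound k = 1 := by
  rw [compound_eq_toMatrix, Matrix.toLin'_one, exteriorPower.map_id, LinearMap.toMatrix_id]

lemma compound_star (A : Matrix (Fin n) (Fin n) ℂ) :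
    (star A).compound k = star (A.compound k) := by
  ext s t
  simp [compound, Matrix.star_eq_conjTranspose, ← Matrix.conjTranspose_submatrix,
    Matrix.det_conjTranspose]

lemma compound_diagonal (d : Fin n → ℂ) :
    (Matrix.diagonal d).compound k = Matrix.diagonal fun s => ∏ i ∈ s.1, d i := by
  rw [compound_eq_toMatrix]
  ext s t
  rw [LinearMap.toMatrix_apply, exteriorPower.basis_apply,
    exteriorPower.map_apply_ιMulti_family, exteriorPower.ιMulti_family]
  have h : (⇑(Matrix.toLin' (diagonal d)) ∘ ⇑(Pi.basisFun ℂ (Fin n))) ∘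
      ⇑(Set.powersetCard.ofFinEmbEquiv.symm t) = fun i =>
        d (Set.powersetCard.ofFinEmbEquiv.symm t i) •
        (Pi.basisFun ℂ (Fin n)) (Set.powersetCard.ofFinEmbEquiv.symm t i) := by
    ext i j
    simp [Matrix.toLin'_apply, Matrix.mulVec_single, Pi.single_apply]
  have h2 : ∏ i, d (Set.powersetCard.ofFinEmbEquiv.symm t i) = ∏ i ∈ t.1, d i := by
    rw [← Finset.prod_coe_sort t.1]
    exact (t.1.orderIsoOfFin t.2).toEquiv.prod_comp (fun x => d x)
  erw [h, AlternatingMap.map_smul_univ]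
  rw [h2]
  have := exteriorPower.basis_repr ℂ k (Pi.basisFun ℂ (Fin n)) t
  erw [map_smul, this]
  by_cases hst : s = t
  · subst hst; simp
  · simp [hst]

lemma continuous_compound :
    Continuous (compound k : Matrix (Fin n) (Fin n) ℂ → Matrix _ _ ℂ) := by
  refine continuous_matrix fun s t => ?_
  exact (continuous_id.matrix_submatrix _ _).matrix_det

lemma compound_mem_unitary {U : Matrix (Fin n) (Fin n) ℂ}
    (hU : U ∈ unitary (Matrix (Fin n) (Fin n) ℂ)) :
    U.compound k ∈ unitary (Matrix (Set.powersetCard (Fin n) k) (Set.powersetCard (Fin n) k) ℂ) := by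
  rw [Unitary.mem_iff] at hU ⊢
  rw [← compound_star, ← compound_mul, ← compound_mul, hU.1, hU.2, compound_one]
  simp

lemma compound_nonneg {A : Matrix (Fin n) (Fin n) ℂ} (hA : 0 ≤ A) : 0 ≤ A.compound k := by
  obtain ⟨B, rfl⟩ := CStarAlgebra.nonneg_iff_eq_star_mul_self.mp hA
  rw [compound_mul, compound_star]
  exact star_mul_self_nonneg _

end Matrix
end

/-! ### Spectra, powers and norms of compounds -/

section
variable {n k : ℕ}
open Matrix

/-- On the finitely many values of `g`, `f` agrees with its Lagrange interpolant, and polynomials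
commute with the algebra homomorphism `φ`. -/
theorem cfc_unitary_conj_diagonal {ι : Type*} [Fintype ι] [DecidableEq ι]
    (U : unitary (Matrix ι ι ℂ)) (g : ι → ℝ) (f : ℝ → ℝ) :
    cfc f ((U : Matrix ι ι ℂ) * diagonal (fun i => (g i : ℂ)) * star (U : Matrix ι ι ℂ)) =
      (U : Matrix ι ι ℂ) * diagonal (fun i => (f (g i) : ℂ)) * star (U : Matrix ι ι ℂ) := by
  let φ : (ι → ℝ) →ₐ[ℝ] Matrix ι ι ℂ :=
    (((Unitary.conjStarAlgAut ℝ (Matrix ι ι ℂ) U : Matrix ι ι ℂ ≃⋆ₐ[ℝ] Matrix ι ι ℂ) :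
      Matrix ι ι ℂ →ₐ[ℝ] Matrix ι ι ℂ).comp (diagonalAlgHom ℝ)).comp
        (AlgHom.compLeft (Algebra.ofId ℝ ℂ) ι)
  have hφ (h : ι → ℝ) : φ h =
      (U : Matrix ι ι ℂ) * diagonal (fun i => (h i : ℂ)) * star (U : Matrix ι ι ℂ) := by
    simp [φ, Unitary.conjStarAlgAut_apply]
    rfl
  rw [← hφ, ← hφ (fun i => f (g i))]
  have hsa : IsSelfAdjoint (φ g) := by
    rw [hφ, IsSelfAdjoint, star_mul, star_mul, star_star, mul_assoc,
      Matrix.star_eq_conjTranspose (diagonal _),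
      diagonal_conjTranspose]
    congr! 3
    ext i
    simp
  let P := Lagrange.interpolate (Finset.univ.image g) id f
  have hP (i : ι) : P.eval (g i) = f (g i) :=
    Lagrange.eval_interpolate_at_node f (Set.injOn_id _) (by simp)
  have hspec : Set.EqOn f P.eval (spectrum ℝ (φ g)) := by
    intro x hx
    have := AlgHom.spectrum_apply_subset φ g hx
    rw [Pi.spectrum_eq] at this
    obtain ⟨i, hi⟩ := Set.mem_iUnion.1 this
    have hx : x = g i := by
      rw [← Algebra.algebraMap_self_apply (R := ℝ) (g i), spectrum.scalar_eq] at hi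
      simpa using hi
    rw [hx]
    exact (hP i).symm
  rw [cfc_congr hspec, cfc_polynomial P _ hsa, Polynomial.aeval_algHom_apply, Polynomial.aeval_pi_apply]
  congr 1
  ext i
  simpa using hP i

theorem Matrix.IsHermitian.eq_unitary_conj {ι : Type*} [Fintype ι] [DecidableEq ι]
    {A : Matrix ι ι ℂ} (hA : A.IsHermitian) :
    A = (hA.eigenvectorUnitary : Matrix ι ι ℂ) * diagonal (fun i => (hA.eigenvalues i : ℂ)) *
      star (hA.eigenvectorUnitary : Matrix ι ι ℂ) := by
  conv_lhs => rw [hA.spectral_theorem, Unitary.conjStarAlgAut_apply]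
  rfl

/-- The explicit `F` selects which occurrences of `A` are diagonalized, sparing those inside `hA`.
-/
theorem Matrix.IsHermitian.eigenvectorUnitary_conj_congr {ι α : Type*} [Fintype ι] [DecidableEq ι]
    {A : Matrix ι ι ℂ} (hA : A.IsHermitian) (F : Matrix ι ι ℂ → α) :
    F A = F ((hA.eigenvectorUnitary : Matrix ι ι ℂ) *
      diagonal (fun i => (hA.eigenvalues i : ℂ)) * star (hA.eigenvectorUnitary : Matrix ι ι ℂ)) :=
  congrArg F hA.eq_unitary_conj

/-- The compound of a unitary matrix, as a unitary matrix. -/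
noncomputable def Matrix.unitaryCompound (k : ℕ) (U : unitary (Matrix (Fin n) (Fin n) ℂ)) :
    unitary (Matrix (Set.powersetCard (Fin n) k) (Set.powersetCard (Fin n) k) ℂ) :=
  ⟨(U : Matrix (Fin n) (Fin n) ℂ).compound k, compound_mem_unitary U.2⟩

theorem compound_unitary_conj_diagonal (U : unitary (Matrix (Fin n) (Fin n) ℂ)) (g : Fin n → ℝ) :
    ((U : Matrix _ _ ℂ) * diagonal (fun i => (g i : ℂ)) * star (U : Matrix _ _ ℂ)).compound k =
      (unitaryCompound k U : Matrix _ _ ℂ) * diagonal (fun s => ((∏ i ∈ s.1, g i : ℝ) : ℂ)) *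
        star (unitaryCompound k U : Matrix _ _ ℂ) := by
  rw [compound_mul, compound_mul, compound_diagonal, compound_star]
  simp [unitaryCompound]

/-- Compounds commute with real powers of positive semidefinite matrices. -/
theorem compound_rpow {A : Matrix (Fin n) (Fin n) ℂ} (hA : 0 ≤ A) {r : ℝ} :
    (A ^ r).compound k = A.compound k ^ r := by
  have hH : A.IsHermitian := (nonneg_iff_posSemidef.1 hA).1
  have hpos (i) : 0 ≤ hH.eigenvalues i := (nonneg_iff_posSemidef.1 hA).eigenvalues_nonneg i
  rw [CFC.rpow_eq_cfc_real (a := A), CFC.rpow_eq_cfc_real (a := A.compound k) (ha := compound_nonneg hA)]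
  rw [hH.eigenvectorUnitary_conj_congr (fun B => (cfc (fun x : ℝ => x ^ r) B).compound k),
    hH.eigenvectorUnitary_conj_congr (fun B => cfc (fun x : ℝ => x ^ r) (B.compound k)),
    cfc_unitary_conj_diagonal, compound_unitary_conj_diagonal, compound_unitary_conj_diagonal, cfc_unitary_conj_diagonal]
  congr! 4
  rw [Real.finsetProd_rpow _ _ fun i _ => hpos i]

theorem norm_compound_hermitian {A : Matrix (Fin n) (Fin n) ℂ} (hA : A.IsHermitian) :
    ‖A.compound k‖ = ‖fun s : Set.powersetCard (Fin n) k => ∏ i ∈ s.1, hA.eigenvalues i‖ := by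
  rw [hA.eigenvectorUnitary_conj_congr (fun B => ‖B.compound k‖), compound_unitary_conj_diagonal,
    ← Unitary.coe_star, CStarRing.norm_mul_coe_unitary, CStarRing.norm_coe_unitary_mul,
    l2_opNorm_diagonal]
  simp [Pi.norm_def]

theorem norm_compound_le_one {K : Matrix (Fin n) (Fin n) ℂ} (h1 : K ≤ 1) (h2 : -1 ≤ K)
    (hK : K.IsHermitian) :
    ‖K.compound k‖ ≤ 1 := by
  have hsa : IsSelfAdjoint K := hK
  have hle (i) : hK.eigenvalues i ≤ 1 :=
    (le_algebraMap_iff_spectrum_le (R := ℝ) (a := K) (r := 1) hsa).1 (by simpa using h1) _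
      (hK.eigenvalues_mem_spectrum_real i)
  have hge (i) : -1 ≤ hK.eigenvalues i :=
    (algebraMap_le_iff_le_spectrum (R := ℝ) (a := K) (r := -1) hsa).1 (by simpa using h2) _
      (hK.eigenvalues_mem_spectrum_real i)
  rw [norm_compound_hermitian hK, pi_norm_le_iff_of_nonneg zero_le_one]
  intro s
  rw [norm_prod]
  exact Finset.prod_le_one (fun i _ => norm_nonneg _) fun i _ => abs_le.2 ⟨hge i, hle i⟩

theorem Finset.prod_le_prod_initial {m : ℕ} {f : Fin m → ℝ} (hf : Antitone f) (h0 : ∀ i, 0 ≤ f i)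
    (s : Finset (Fin m)) (hs : s.card = k) :
    ∏ i ∈ s, f i ≤ ∏ i : Fin m with i.val < k, f i := by
  have hk : k ≤ m := by simpa [hs] using s.card_le_univ
  have h1 : ∏ i : Fin m with i.val < k, f i = ∏ i : Fin k, f (Fin.castLE hk i) := by
    refine Eq.trans ?_ (Finset.prod_map Finset.univ (Fin.castLEEmb hk) f)
    congr 1
    ext i
    simp only [Finset.mem_filter, Finset.mem_univ, true_and, Finset.mem_map, Fin.castLEEmb_apply]
    exact ⟨fun h => ⟨⟨i, h⟩, rfl⟩, by rintro ⟨j, rfl⟩; exact j.2⟩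
  have h2 : ∏ i ∈ s, f i = ∏ i : Fin k, f (s.orderEmbOfFin hs i) := by
    rw [← Finset.prod_coe_sort s]
    exact ((s.orderIsoOfFin hs).toEquiv.prod_comp (fun x => f x)).symm
  rw [h1, h2]
  refine Finset.prod_le_prod (fun i _ => h0 _) fun i _ => hf ?_
  -- Counting from zero, the `j`-th element of `s` is at least `j`, so `f` is no larger there than
  -- at `j`.
  have key : ∀ (j : ℕ) (hj : j < k), j ≤ (s.orderEmbOfFin hs ⟨j, hj⟩ : ℕ) := by
    intro j
    induction j with
    | zero => simp
    | succ j ih =>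
      intro hj
      refine (ih (by omega)).trans_lt ?_
      exact (s.orderEmbOfFin hs).strictMono (a := ⟨j, by omega⟩) (b := ⟨j + 1, hj⟩)
        (by simp [Fin.lt_def])
  exact key i i.2

/-- The norm of the `k`-th compound is the product of the `k` largest eigenvalues. -/
theorem norm_compound_posSemidef {A : Matrix (Fin n) (Fin n) ℂ} (hA : A.PosSemidef) (hk : k ≤ n) :
    ‖A.compound k‖ =
      ∏ j : Fin (Fintype.card (Fin n)) with j.val < k, hA.isHermitian.eigenvalues₀ j := by
  let e : Fin (Fintype.card (Fin n)) ≃ Fin n := Fintype.equivOfCardEq (Fintype.card_fin _)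
  have he (i) : hA.isHermitian.eigenvalues i = hA.isHermitian.eigenvalues₀ (e.symm i) := rfl
  have h0 (j) : 0 ≤ hA.isHermitian.eigenvalues₀ j := by
    simpa [he] using hA.eigenvalues_nonneg (e j)
  rw [norm_compound_hermitian hA.isHermitian]
  apply le_antisymm
  · rw [pi_norm_le_iff_of_nonneg (Finset.prod_nonneg fun j _ => h0 j)]
    intro s
    rw [Real.norm_of_nonneg (Finset.prod_nonneg fun i _ => hA.eigenvalues_nonneg i)]
    have := Finset.prod_le_prod_initial hA.isHermitian.eigenvalues₀_antitone h0
      (s.1.map e.symm.toEmbedding) ((Finset.card_map _).trans s.2)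
    rwa [Finset.prod_map] at this
  -- The bound is attained at the index set of the `k` largest eigenvalues.
  · have hcard : (({j : Fin (Fintype.card (Fin n)) | j.val < k} : Finset _).map e.toEmbedding).card
        = k := by
      rw [Finset.card_map, Fin.card_filter_val_lt, Fintype.card_fin, min_eq_right hk]
    refine le_trans ?_ (norm_le_pi_norm _ ⟨_, hcard⟩)
    refine le_trans (le_of_eq ?_) (le_abs_self _)
    rw [Finset.prod_map]
    simp [he]
end

/-! ### Operator bounds for the real part -/

section
variable {n : ℕ}
open Matrix

/-- Operator concavity of `t ↦ t ^ (1 / p)`, in power-mean form. -/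
theorem smul_add_le_rpow_mean (B C : Matrix (Fin n) (Fin n) ℂ) (hB : 0 ≤ B) (hC : 0 ≤ C)
    {p : ℝ} (hp : 1 ≤ p) :
    (2⁻¹ : ℝ) • (B + C) ≤ ((2⁻¹ : ℝ) • (B ^ p + C ^ p)) ^ p⁻¹ := by
  have hp0 : p ≠ 0 := by positivity
  have hB' : 0 ≤ B ^ p := CFC.rpow_nonneg
  have hC' : 0 ≤ C ^ p := CFC.rpow_nonneg
  have h := (CFC.concaveOn_rpow (A := Matrix (Fin n) (Fin n) ℂ) (p := p⁻¹)
    ⟨by positivity, inv_le_one_of_one_le₀ hp⟩).2 hB' hC'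
     (show (0 : ℝ) ≤ 2⁻¹ by norm_num) (show (0 : ℝ) ≤ 2⁻¹ by norm_num) (by norm_num)
  dsimp only at h
  rw [CFC.rpow_rpow_of_exponent_nonneg _ _ _ (by positivity) (by positivity),
    CFC.rpow_rpow_of_exponent_nonneg _ _ _ (by positivity) (by positivity),
    mul_inv_cancel₀ hp0, CFC.rpow_one _, CFC.rpow_one _] at h
  simpa [smul_add] using h

/-- The absolute value of the Hermitian dilation of `T`. -/
theorem abs_fromBlocks_offDiag (T : Matrix (Fin n) (Fin n) ℂ) :
    CFC.abs (fromBlocks 0 T (star T) 0) =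
      fromBlocks (CFC.abs (star T)) 0 0 (CFC.abs T) := by
  refine CFC.sqrt_unique ?_ ?_
  · rw [Matrix.star_eq_conjTranspose (fromBlocks _ _ _ _), fromBlocks_conjTranspose,
      fromBlocks_multiply,      fromBlocks_multiply]
    simp [CFC.abs_mul_abs, Matrix.star_eq_conjTranspose]
  · have h1 := nonneg_iff_posSemidef.1 (CFC.abs_nonneg (star T))
    have h2 := nonneg_iff_posSemidef.1 (CFC.abs_nonneg T)
    rw [nonneg_iff_posSemidef, Matrix.posSemidef_iff_dotProduct_mulVec]
    refine ⟨?_, fun x => ?_⟩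
    · rw [IsHermitian, fromBlocks_conjTranspose, h1.1.eq, h2.1.eq]; simp
    · rw [fromBlocks_mulVec, dotProduct, Fintype.sum_sum_type]
      have := add_nonneg (h1.dotProduct_mulVec_nonneg (x ∘ Sum.inl))
        (h2.dotProduct_mulVec_nonneg (x ∘ Sum.inr))
      simpa [dotProduct] using this

/-- For the Hermitian dilation `Z` of `-T`, `|Z| + Z` is twice the positive part of `Z`. Compressing
it by the block column `(1, 1)` gives `|T*| + |T| - T - T* ≥ 0`. -/
theorem re_le_mean_abs (T : Matrix (Fin n) (Fin n) ℂ) :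
    (2⁻¹ : ℝ) • (T + star T) ≤ (2⁻¹ : ℝ) • (CFC.abs T + CFC.abs (star T)) := by
  have hZ : IsSelfAdjoint (fromBlocks 0 (-T) (star (-T)) 0) := by
    rw [IsSelfAdjoint, Matrix.star_eq_conjTranspose (fromBlocks _ _ _ _), fromBlocks_conjTranspose]
    simp [Matrix.star_eq_conjTranspose]
  have h : 0 ≤ CFC.abs (fromBlocks 0 (-T) (star (-T)) 0) + fromBlocks 0 (-T) (star (-T)) 0 := by
    rw [CFC.abs_add_self _ hZ]
    exact nsmul_nonneg (CFC.posPart_nonneg _) 2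
  rw [abs_fromBlocks_offDiag, star_neg, CFC.abs_neg, CFC.abs_neg, fromBlocks_add] at h
  have h' := (nonneg_iff_posSemidef.1 h).conjTranspose_mul_mul_same
    (fromRows 1 1 : Matrix (Fin n ⊕ Fin n) (Fin n) ℂ)
  refine smul_le_smul_of_nonneg_left ?_ (by norm_num)
  rw [Matrix.le_iff]
  convert h' using 1
  rw [Matrix.mul_assoc, fromBlocks_mul_fromRows, conjTranspose_fromRows_eq_fromCols_conjTranspose,
    fromCols_mul_fromRows]
  simp
  abel

end
-- The Cordes inequality
section
variable {A : Type*} [CStarAlgebra A] [PartialOrder A] [StarOrderedRing A]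

theorem smul_rpow {b : A} (hb : 0 ≤ b) {t r : ℝ} (ht : 0 ≤ t) (hr : 0 ≤ r) :
    (t • b) ^ r = t ^ r • b ^ r := by
  rw [CFC.rpow_eq_cfc_real (a := b), CFC.rpow_eq_cfc_real (a := t • b) (ha := smul_nonneg ht hb),
    ← cfc_smul (t ^ r) (fun x : ℝ => x ^ r) b
      (Real.continuous_rpow_const hr).continuousOn,
    ← cfc_comp_smul t (fun x : ℝ => x ^ r) b
      (Real.continuous_rpow_const hr).continuousOn]
  refine cfc_congr fun x hx => ?_
  simp only [smul_eq_mul]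
  exact Real.mul_rpow ht (spectrum_nonneg_of_nonneg hb hx)

/-- The Cordes inequality. -/
theorem norm_mul_rpow_le_norm_rpow_mul_rpow {a q : A} (ha : 0 ≤ a) (hq : IsStrictlyPositive q) {p : ℝ}
    (hp : 1 ≤ p) :
    ‖a * q‖ ^ p ≤ ‖a ^ p * q ^ p‖ := by
  have hp0 : 0 < p := by positivity
  set c := ‖a ^ p * q ^ p‖
  have hsa (b : A) (r : ℝ) : star (b ^ r) = b ^ r := (CFC.rpow_nonneg (a := b) (y := r)).isSelfAdjoint
  have hsq {b : A} (hb : 0 ≤ b) {r : ℝ} (hr : 0 ≤ r) : b ^ r * b ^ r = (b * b) ^ r := by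
    have h2 : b * b = b ^ (2 : ℝ) := by
      rw [show (2 : ℝ) = (2 : ℕ) by norm_num, CFC.rpow_natCast b 2, sq]
    have h3 : b ^ r * b ^ r = (b ^ r) ^ (2 : ℝ) := by
      rw [show (2 : ℝ) = (2 : ℕ) by norm_num, CFC.rpow_natCast (b ^ r) 2 CFC.rpow_nonneg, sq]
    rw [h2, h3, CFC.rpow_rpow_of_exponent_nonneg _ _ _ hr (by norm_num),
      CFC.rpow_rpow_of_exponent_nonneg _ _ _ (by norm_num) hr, mul_comm]
  have hq0 : 0 ≤ q := hq.nonneg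
  have h1 : q ^ p * (a * a) ^ p * q ^ p ≤ algebraMap ℝ A (c ^ 2) := by
    have := CStarAlgebra.star_mul_le_algebraMap_norm_sq (a := a ^ p * q ^ p)
    rw [star_mul, hsa, hsa] at this
    rw [← hsq ha hp0.le]
    simpa only [mul_assoc] using this
  have hcomm : q ^ (-p) * q ^ p = 1 := CFC.rpow_neg_mul_rpow p hq
  have hcomm' : q ^ p * q ^ (-p) = 1 := CFC.rpow_mul_rpow_neg p hq
  have h2 : (a * a) ^ p ≤ c ^ 2 • (q ^ (-p) * q ^ (-p)) := by
    have := conjugate_le_conjugate_of_nonneg h1 (CFC.rpow_nonneg (a := q) (y := -p))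
    have e : q ^ (-p) * (q ^ p * (a * a) ^ p * q ^ p) * q ^ (-p) = (a * a) ^ p := by
      calc _ = (q ^ (-p) * q ^ p) * (a * a) ^ p * (q ^ p * q ^ (-p)) := by simp only [mul_assoc]
        _ = _ := by rw [hcomm, hcomm', one_mul, mul_one]
    rw [e, Algebra.algebraMap_eq_smul_one, mul_smul_comm, smul_mul_assoc, mul_one] at this
    exact this
  -- Löwner–Heinz with exponent `1/p ≤ 1` turns `a^(2p) ≤ c² q^(-2p)` into `a² ≤ c^(2/p) q^(-2)`.
  have h3 := CFC.monotone_rpow (A := A) (p := p⁻¹)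
    ⟨by positivity, inv_le_one_of_one_le₀ hp⟩ h2
  have haa : 0 ≤ a * a := by simpa [ha.isSelfAdjoint.star_eq] using star_mul_self_nonneg a
  have e1 : ((a * a) ^ p) ^ p⁻¹ = a * a := by
    rw [CFC.rpow_rpow_of_exponent_nonneg _ _ _ hp0.le (by positivity), mul_inv_cancel₀ hp0.ne',
      CFC.rpow_one _]
  have e2 : (c ^ 2 • (q ^ (-p) * q ^ (-p))) ^ p⁻¹ =
      (c ^ 2) ^ p⁻¹ • (q ^ (-1 : ℝ) * q ^ (-1 : ℝ)) := by
    have i1 : q ^ (-p) * q ^ (-p) = q ^ (-p + -p) := (CFC.rpow_add hq.isUnit).symm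
    have i2 : q ^ (-1 : ℝ) * q ^ (-1 : ℝ) = q ^ (-1 + -1 : ℝ) := (CFC.rpow_add hq.isUnit).symm
    rw [i1, i2, smul_rpow CFC.rpow_nonneg (by positivity) (by positivity),
      CFC.rpow_rpow q _ _ (by linarith) hq]
    congr 2
    field_simp
  dsimp only at h3
  rw [e1, e2] at h3
  have h4 := conjugate_le_conjugate_of_nonneg h3 hq0
  have e3 : q * ((c ^ 2) ^ p⁻¹ • (q ^ (-1 : ℝ) * q ^ (-1 : ℝ))) * q =
      algebraMap ℝ A ((c ^ 2) ^ p⁻¹) := by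
    have i1 : q * q ^ (-1 : ℝ) = 1 := by
      simpa [CFC.rpow_one q] using CFC.rpow_mul_rpow_neg (1 : ℝ) hq
    have i2 : q ^ (-1 : ℝ) * q = 1 := by
      simpa [CFC.rpow_one q] using CFC.rpow_neg_mul_rpow (1 : ℝ) hq
    rw [Algebra.algebraMap_eq_smul_one, mul_smul_comm, smul_mul_assoc, mul_assoc, mul_assoc, i2,
      mul_one, i1]
  have h5 : star (a * q) * (a * q) ≤ algebraMap ℝ A ((c ^ 2) ^ p⁻¹) := by
    rw [← e3, star_mul, ha.isSelfAdjoint.star_eq, hq0.isSelfAdjoint.star_eq]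
    simpa only [mul_assoc] using h4
  have h6 := (CStarAlgebra.norm_le_iff_le_algebraMap _ (by positivity)
    (star_mul_self_nonneg (a * q))).2 h5
  rw [CStarRing.norm_star_mul_self, ← sq] at h6
  have h7 := Real.rpow_le_rpow (by positivity) h6 hp0.le
  rw [← Real.rpow_mul (by positivity), inv_mul_cancel₀ hp0.ne', Real.rpow_one,
    ← Real.rpow_natCast, ← Real.rpow_natCast, ← Real.rpow_mul (by positivity), mul_comm,
    Real.rpow_mul (by positivity)] at h7
  exact (Real.rpow_le_rpow_iff (by positivity) (by positivity) (by norm_num)).1 h7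
end

/-! ### The compound norm estimate -/

section
variable {n k : ℕ}
open Matrix

theorem isStrictlyPositive_compound {S : Matrix (Fin n) (Fin n) ℂ} (hS : IsStrictlyPositive S) :
    IsStrictlyPositive (S.compound k) := by
  refine ⟨compound_nonneg hS.nonneg, ?_⟩
  obtain ⟨u, hu⟩ := hS.isUnit
  refine ⟨⟨S.compound k, (↑u⁻¹ : Matrix (Fin n) (Fin n) ℂ).compound k, ?_, ?_⟩, rfl⟩
  · rw [← compound_mul, ← hu, Units.mul_inv, compound_one]
  · rw [← compound_mul, ← hu, Units.inv_mul, compound_one]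

theorem norm_compound_conj_le {A H R : Matrix (Fin n) (Fin n) ℂ} (hA : 0 ≤ A)
    (hH : H.IsHermitian) (hR : IsStrictlyPositive R) {p : ℝ} (hp : 1 ≤ p) (h1 : H ≤ R ^ p⁻¹)
    (h2 : -(R ^ p⁻¹) ≤ H) :
    ‖(A * H * A).compound k‖ ^ p ≤ ‖(A ^ p * R * A ^ p).compound k‖ := by
  have hp0 : 0 < p := by positivity
  -- With `S = R^r`, this exponent gives both `S S = R^(1/p)` and `S^p = R^(1/2)`.
  set r : ℝ := p⁻¹ / 2 with hr
  have hr0 : 0 < r := by positivity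
  have hSpos : IsStrictlyPositive (R ^ r) := hR.rpow R r
  have hstar (B : Matrix (Fin n) (Fin n) ℂ) (x : ℝ) : star (B ^ x) = B ^ x :=
    (CFC.rpow_nonneg (a := B) (y := x)).isSelfAdjoint
  have hSi : R ^ r * R ^ (-r) = 1 := CFC.rpow_mul_rpow_neg r hR
  have hiS : R ^ (-r) * R ^ r = 1 := CFC.rpow_neg_mul_rpow r hR
  have hSS : R ^ p⁻¹ = R ^ r * R ^ r := by
    rw [← CFC.rpow_add hR.isUnit, hr, add_halves]
  have hone : R ^ (-r) * R ^ p⁻¹ * R ^ (-r) = 1 := by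
    rw [hSS, ← mul_assoc, hiS, one_mul, hSi]
  have hi0 : 0 ≤ R ^ (-r) := CFC.rpow_nonneg
  have hK1 : R ^ (-r) * H * R ^ (-r) ≤ 1 := by
    simpa only [hone] using conjugate_le_conjugate_of_nonneg h1 hi0
  have hK2 : -1 ≤ R ^ (-r) * H * R ^ (-r) := by
    have := conjugate_le_conjugate_of_nonneg h2 hi0
    rwa [mul_neg, neg_mul, hone] at this
  have hK : (R ^ (-r) * H * R ^ (-r)).IsHermitian := by
    rw [IsHermitian, ← star_eq_conjTranspose, star_mul, star_mul, hstar, star_eq_conjTranspose H,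
      hH.eq, mul_assoc]
  have hfac : A * H * A = (A * R ^ r) * (R ^ (-r) * H * R ^ (-r)) * star (A * R ^ r) := by
    rw [star_mul, hstar, hA.isSelfAdjoint.star_eq]
    calc A * H * A = A * 1 * H * 1 * A := by simp
      _ = A * (R ^ r * R ^ (-r)) * H * (R ^ (-r) * R ^ r) * A := by rw [hSi, hiS]
      _ = _ := by simp only [mul_assoc]
  have hnorm : ‖(A * H * A).compound k‖ ≤ ‖A.compound k * (R ^ r).compound k‖ ^ 2 := by
    rw [hfac, compound_mul, compound_mul, compound_star, ← compound_mul A]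
    calc _ ≤ ‖(A * R ^ r).compound k‖ * ‖(R ^ (-r) * H * R ^ (-r)).compound k‖ *
          ‖star ((A * R ^ r).compound k)‖ :=
        (norm_mul_le _ _).trans (mul_le_mul_of_nonneg_right (norm_mul_le _ _) (norm_nonneg _))
      _ ≤ ‖(A * R ^ r).compound k‖ * 1 * ‖(A * R ^ r).compound k‖ := by
        rw [norm_star]
        gcongr
        exact norm_compound_le_one hK1 hK2 hK
      _ = _ := by ring
  have hcordes := norm_mul_rpow_le_norm_rpow_mul_rpow (compound_nonneg (k := k) hA)
    (isStrictlyPositive_compound (k := k) hSpos) hp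
  rw [← compound_rpow hA, ← compound_rpow hSpos.nonneg,
    ← compound_mul (A ^ p), CFC.rpow_rpow R _ _ hr0.ne' hR] at hcordes
  have hhalf : r * p = 2⁻¹ := by rw [hr]; field_simp
  have hfac' : A ^ p * R * A ^ p = (A ^ p * R ^ (2⁻¹ : ℝ)) * star (A ^ p * R ^ (2⁻¹ : ℝ)) := by
    rw [star_mul, hstar, hstar, ← mul_assoc, mul_assoc (A ^ p) _ (R ^ (2⁻¹ : ℝ)),
      ← CFC.rpow_add hR.isUnit]
    norm_num
    rw [CFC.rpow_one R hR.nonneg]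
  rw [hhalf] at hcordes
  rw [hfac', compound_mul (A ^ p * R ^ (2⁻¹ : ℝ)), compound_star, CStarRing.norm_self_mul_star]
  calc ‖(A * H * A).compound k‖ ^ p ≤ (‖A.compound k * (R ^ r).compound k‖ ^ 2) ^ p :=
      Real.rpow_le_rpow (norm_nonneg _) hnorm hp0.le
    _ = (‖A.compound k * (R ^ r).compound k‖ ^ p) ^ 2 := by
      rw [← Real.rpow_natCast, ← Real.rpow_natCast, ← Real.rpow_mul (norm_nonneg _),
        ← Real.rpow_mul (norm_nonneg _), mul_comm]
    _ ≤ ‖(A ^ p * R ^ (2⁻¹ : ℝ)).compound k‖ ^ 2 :=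
      pow_le_pow_left₀ (Real.rpow_nonneg (norm_nonneg _) _) hcordes 2
    _ = _ := sq _

theorem re_le_rpow_mean_abs (T : Matrix (Fin n) (Fin n) ℂ) {p : ℝ} (hp : 1 ≤ p) :
    (2⁻¹ : ℝ) • (T + star T) ≤ ((2⁻¹ : ℝ) • (CFC.abs T ^ p + CFC.abs (star T) ^ p)) ^ p⁻¹ :=
  (re_le_mean_abs T).trans (smul_add_le_rpow_mean _ _ (CFC.abs_nonneg _) (CFC.abs_nonneg _) hp)

theorem norm_compound_re_conj_le {A T : Matrix (Fin n) (Fin n) ℂ} (hA : 0 ≤ A) {p : ℝ}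
    (hp : 1 ≤ p) :
    ‖(A * ((2⁻¹ : ℝ) • (T + star T)) * A).compound k‖ ^ p ≤
      ‖(A ^ p * ((2⁻¹ : ℝ) • (CFC.abs T ^ p + CFC.abs (star T) ^ p)) * A ^ p).compound k‖ := by
  set N := (2⁻¹ : ℝ) • (CFC.abs T ^ p + CFC.abs (star T) ^ p) with hN
  have hN0 : 0 ≤ N := smul_nonneg (by norm_num) (add_nonneg CFC.rpow_nonneg CFC.rpow_nonneg)
  -- `N` may be singular, while the factorization needs negative powers; hence the shift by `ε`.
  have hlim : Filter.Tendsto (fun ε : ℝ => ‖(A ^ p * (N + ε • 1) * A ^ p).compound k‖)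
      (nhdsWithin 0 (Set.Ioi 0)) (nhds ‖(A ^ p * N * A ^ p).compound k‖) := by
    have hc : Continuous (fun ε : ℝ => ‖(A ^ p * (N + ε • 1) * A ^ p).compound k‖) :=
      (continuous_compound.comp (by fun_prop)).norm
    simpa using (hc.tendsto 0).mono_left nhdsWithin_le_nhds
  refine ge_of_tendsto hlim ?_
  filter_upwards [self_mem_nhdsWithin] with ε hε
  have hε : 0 < ε := hε
  have hle : N ≤ N + ε • 1 := le_add_of_nonneg_right (smul_nonneg hε.le zero_le_one)
  have hR : IsStrictlyPositive (N + ε • (1 : Matrix (Fin n) (Fin n) ℂ)) := by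
    refine IsStrictlyPositive.nonneg_add hN0 (Matrix.PosDef.isStrictlyPositive ?_)
    exact Matrix.PosDef.one.smul hε
  have hmono : N ^ p⁻¹ ≤ (N + ε • 1) ^ p⁻¹ :=
    CFC.rpow_le_rpow ⟨by positivity, inv_le_one_of_one_le₀ hp⟩ hle
  refine norm_compound_conj_le hA ?_ hR hp ?_ ?_
  · have : IsSelfAdjoint ((2⁻¹ : ℝ) • (T + star T)) :=
      (IsSelfAdjoint.all (2⁻¹ : ℝ)).smul (IsSelfAdjoint.add_star_self T)
    exact this
  · exact (re_le_rpow_mean_abs T hp).trans hmono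
  -- The lower bound is the upper bound for `-T`, which has the same `N`.
  · rw [neg_le]
    refine le_trans ?_ ((re_le_rpow_mean_abs (-T) hp).trans ?_)
    · rw [star_neg, ← neg_add, smul_neg]
    · rw [star_neg, CFC.abs_neg, CFC.abs_neg]
      exact hmono

/-- Since `|X|² = X*X`, the compounds of `|X|` and `X` have equal norm by the C*-identity. -/
theorem norm_compound_abs_rpow (X : Matrix (Fin n) (Fin n) ℂ) {p : ℝ} (hp : 0 < p) :
    ‖(CFC.abs X ^ p).compound k‖ = ‖X.compound k‖ ^ p := by
  rw [compound_rpow (CFC.abs_nonneg X), CFC.norm_rpow _ hp (compound_nonneg (CFC.abs_nonneg X))]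
  have h : ‖(CFC.abs X).compound k‖ * ‖(CFC.abs X).compound k‖ = ‖X.compound k‖ * ‖X.compound k‖ := by
    rw [← CStarRing.norm_star_mul_self, ← CStarRing.norm_star_mul_self, ← compound_star,
      ← compound_star, ← compound_mul, ← compound_mul, (CFC.abs_nonneg X).isSelfAdjoint.star_eq,
      CFC.abs_mul_abs]
  rw [(mul_self_inj (norm_nonneg _) (norm_nonneg _)).1 h]

end

end

theorem mainTheorem7 (n : ℕ) (A T : Matrix (Fin n) (Fin n) ℂ) (hA : A.PosSemidef)
    (p : ℝ) (hp : 1 ≤ p) :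
    WeakLogMajorizedBy
      (CFC.abs (A * ((2⁻¹ : ℝ) • (T + star T)) * A) ^ p)
      (A ^ p * ((2⁻¹ : ℝ) • (CFC.abs T ^ p + CFC.abs (star T) ^ p)) * A ^ p) := by
  have hA' : 0 ≤ A := Matrix.nonneg_iff_posSemidef.2 hA
  have hX : (CFC.abs (A * ((2⁻¹ : ℝ) • (T + star T)) * A) ^ p).PosSemidef :=
    Matrix.nonneg_iff_posSemidef.1 CFC.rpow_nonneg
  have hY : (A ^ p * ((2⁻¹ : ℝ) • (CFC.abs T ^ p + CFC.abs (star T) ^ p)) * A ^ p).PosSemidef :=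
    Matrix.nonneg_iff_posSemidef.1 <| IsSelfAdjoint.conjugate_nonneg
      (smul_nonneg (by norm_num) (add_nonneg CFC.rpow_nonneg CFC.rpow_nonneg))
      CFC.rpow_nonneg.isSelfAdjoint
  refine ⟨hX, hY, fun k _ hk => ?_⟩
  rw [← norm_compound_posSemidef hX hk, ← norm_compound_posSemidef hY hk,
    norm_compound_abs_rpow _ (by positivity)]
  exact norm_compound_re_conj_le hA' hp
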